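/- Let $A\in\mathbb C^{m\times n}$, $B\in\mathbb C^{m\times p}$, $C\in\mathbb C^{q\times n}$ be given and let $t$ be an integer with $0\le t\le\min\{p,q\}$. Write $r(\cdot)$ for the rank, $\mathscr R(\cdot)$ for the range (column space), $A^*$ for the conjugate transpose, $\mathbb C_t^{p\times q}$ for the set of all complex $p\times q$ matrices of rank $t$, and put $$G=[\,A,\;B\,],\qquad H=\begin{bmatrix}A\\ C\end{bmatrix},\qquad M=\begin{bmatrix}A&B\\ C&0\end{bmatrix}.$$ Then the following maximum and minimum are attained and $$\max_{X\in\mathbb C_t^{p\times q}} r(A+BXC)=\min\{\,r(G),\ r(H),\ r(A)+t\,\},$$ $$\min_{X\in\mathbb C_t^{p\times q}} r(A+BXC)=\max\{\,r(G)+r(H)-r(M),\ r(G)+r(H)-r(A)+t-p-q,\ r(A)-t\,\}.$$ Consequently: (a) If $m=n$, there exists $X\in\mathbb C_t^{p\times q}$ such that $A+BXC$ is nonsingular if and only if $r(G)=r(H)=m$ and $r(A)\ge m-t$. (b) There exists $X\in\mathbb C_t^{p\times q}$ such that $A+BXC=0$ if and only if $\mathscr R(A)\subseteq\mathscr R(B)$,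 $\mathscr R(A^*)\subseteq\mathscr R(C^*)$, $r(G)+r(H)\le r(A)-t+p+q$ and $r(A)\le t$. (c) If $t\ne0$, the rank of $A+BXC$ is the same for all $X\in\mathbb C_t^{p\times q}$ if and only if at least one of the following holds: (i) $r(M)=r(G)$; (ii) $r(M)=r(H)$; (iii) $r(M)=r(G)+r(H)-r(A)-t$; (iv) $r(G)=r(A)+p+q-t$; (v) $r(H)=r(A)+p+q-t$; (vi) $r(G)+r(H)=2r(A)+p+q$. Moreover, (vi) holds if and only if $r(B)=p$, $r(C)=q$, $\mathscr R(A)\cap\mathscr R(B)=\{0\}$ and $\mathscr R(A^*)\cap\mathscr R(C^*)=\{0\}$. (d) If $\mathscr R(A)\subseteq\mathscr R(B)$ and $\mathscr R(A^*)\subseteq\mathscr R(C^*)$, then $$\max_{X\in\mathbb C_t^{p\times q}} r(A+BXC)=\min\{\,r(B),\ r(C),\ r(A)+t\,\},$$ $$\min_{X\in\mathbb C_t^{p\times q}} r(A+BXC)=\max\{\,0,\ r(B)+r(C)-r(A)+t-p-q,\ r(A)-t\,\}.$$ -/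

import Mathlib

/-- The set of all complex `p × q` matrices of rank exactly `t`. -/
def fixedRank (p q t : ℕ) : Set (Matrix (Fin p) (Fin q) ℂ) :=
  {X | X.rank = t}

/-- The range (column space) of a complex matrix. -/
def colSpace {m n : ℕ} (A : Matrix (Fin m) (Fin n) ℂ) : Submodule ℂ (Fin m → ℂ) :=
  LinearMap.range A.mulVecLin

/-- The values of `rank (A + B X C)`, as integers, for `X` running over the `p × q` matrices of
rank `t`. -/
def rankValues {m n p q : ℕ} (A : Matrix (Fin m) (Fin n) ℂ) (B : Matrix (Fin m) (Fin p) ℂ)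
    (C : Matrix (Fin q) (Fin n) ℂ) (t : ℕ) : Set ℤ :=
  (fun X : Matrix (Fin p) (Fin q) ℂ => ((A + B * X * C).rank : ℤ)) '' fixedRank p q t

/-! Regard the matrices as linear maps and put `N = A + B X C`. Passing from `A` to `N` changes none
of `R(A) + R(B)`, `ker A ∩ ker C` and `A(ker C)`. These determine `r(G)`, `r(H)` and, through `r(M)
= r(H) + r(B) - dim (A(ker C) ∩ R(B))`, also `r(M)`. The bounds follow by counting dimensions,
except the one involving `p + q`, which is Sylvester's inequality applied twice.

The maximum is reached by rank one steps. Each raises the rank until it meets `r(G)`, `r(H)` or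
`r(A) + t`, and `X` is then padded to rank `t` without loss (`exists_rk_eq_and_rk_le`).

For the minimum, rank one steps lower the rank until `R(N) ∩ R(B)` lies in `A(ker C)`, which takes
`k = r(A) - (r(G) + r(H) - r(M))` steps. If `t ≤ k`, only `t` steps are made. Otherwise only the
part of `X` from `C(ker N)` to `U ⧸ B⁻¹(R(N))` matters for keeping the rank low. The other blocks
are free to enlarge `r(X)` up to a threshold, beyond which each extra unit of `r(X)` costs at most
one unit of rank (`exists_rk_eq_and_rk_le_of_le`). -/

namespace RankPerturbation

open Module LinearMap

set_option linter.unusedSectionVars false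

/-! ### Ranks of linear maps and rank one perturbations -/

section Basic

variable {K : Type*} [Field K]
variable {V₁ V₂ V₃ : Type*} [AddCommGroup V₁] [Module K V₁]
  [AddCommGroup V₂] [Module K V₂] [AddCommGroup V₃] [Module K V₃]

/-- The rank of a linear map, as a natural number. -/
noncomputable abbrev rk (f : V₁ →ₗ[K] V₂) : ℕ := finrank K (range f)

theorem range_add_le (f g : V₁ →ₗ[K] V₂) : range (f + g) ≤ range f ⊔ range g := by
  rintro _ ⟨x, rfl⟩
  exact Submodule.add_mem_sup ⟨x, rfl⟩ ⟨x, rfl⟩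

theorem rk_add_le [FiniteDimensional K V₂] (f g : V₁ →ₗ[K] V₂) : rk (f + g) ≤ rk f + rk g :=
  (Submodule.finrank_mono (range_add_le f g)).trans (Submodule.finrank_add_le_finrank_add_finrank _ _)

theorem rk_neg (f : V₁ →ₗ[K] V₂) : rk (-f) = rk f := by
  rw [rk, range_neg]

theorem rk_comp_le_left [FiniteDimensional K V₃] (f : V₁ →ₗ[K] V₂) (g : V₂ →ₗ[K] V₃) :
    rk (g ∘ₗ f) ≤ rk g :=
  Submodule.finrank_mono (range_comp_le_range f g)

theorem rk_comp_le_right [FiniteDimensional K V₂] (f : V₁ →ₗ[K] V₂) (g : V₂ →ₗ[K] V₃) :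
    rk (g ∘ₗ f) ≤ rk f := by
  rw [rk, range_comp]
  exact Submodule.finrank_map_le g _

theorem rk_conj_le {V₄ : Type*} [AddCommGroup V₄] [Module K V₄] [FiniteDimensional K V₃]
    [FiniteDimensional K V₄]
    (f : V₁ →ₗ[K] V₂) (g : V₂ →ₗ[K] V₃) (h : V₃ →ₗ[K] V₄) : rk (h ∘ₗ g ∘ₗ f) ≤ rk g :=
  (rk_comp_le_right (g ∘ₗ f) h).trans (rk_comp_le_left f g)

theorem rk_smulRight_le_one (f : Dual K V₁) (u : V₂) : rk (f.smulRight u) ≤ 1 := by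
  refine le_trans (Submodule.finrank_mono (t := Submodule.span K {u}) ?_)
    ((finrank_span_le_card _).trans (by simp))
  rintro _ ⟨x, rfl⟩
  exact Submodule.smul_mem _ _ (Submodule.mem_span_singleton_self u)

theorem finrank_map_add_finrank_inf_ker [FiniteDimensional K V₁] (f : V₁ →ₗ[K] V₂)
    (S : Submodule K V₁) :
    finrank K (S.map f) + finrank K (S ⊓ ker f : Submodule K V₁) = finrank K S := by
  have h := (f.domRestrict S).finrank_range_add_finrank_ker
  rw [range_domRestrict] at h
  rw [← h]
  congr 1
  rw [ker_domRestrict, ← Submodule.finrank_map_subtype_eq, Submodule.map_comap_subtype]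

/-- Sylvester's rank inequality. -/
theorem rk_add_rk_le_rk_comp_add [FiniteDimensional K V₁] [FiniteDimensional K V₂]
    (f : V₁ →ₗ[K] V₂) (g : V₂ →ₗ[K] V₃) :
    rk g + rk f ≤ rk (g ∘ₗ f) + finrank K V₂ := by
  have h1 := finrank_map_add_finrank_inf_ker g (range f)
  have h2 := g.finrank_range_add_finrank_ker
  have h3 : finrank K (range f ⊓ ker g : Submodule K V₂) ≤ finrank K (ker g) :=
    Submodule.finrank_mono inf_le_right
  rw [← range_comp] at h1
  simp only [rk]
  omega

theorem apply_eq_zero_of_add_smulRight (f : V₁ →ₗ[K] V₂) {φ : Dual K V₁} {b : V₂}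
    (hb : b ∉ range f) {x : V₁} (hx : (f + φ.smulRight b) x = 0) : f x = 0 ∧ φ x = 0 := by
  have hx' : f x + φ x • b = 0 := hx
  have h0 : φ x = 0 := by
    by_contra h
    apply hb
    refine ⟨-((φ x)⁻¹ • x), ?_⟩
    rw [map_neg, map_smul, eq_neg_of_add_eq_zero_left hx', smul_neg, neg_neg, smul_smul,
      inv_mul_cancel₀ h, one_smul]
  rw [h0, zero_smul, add_zero] at hx'
  exact ⟨hx', h0⟩

/-- A rank one perturbation by `b ⊗ φ` with `b` outside the range and `φ` not vanishing on the
kernel raises the rank by one. -/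
theorem rk_add_smulRight_of_notMem [FiniteDimensional K V₁] [FiniteDimensional K V₂]
    (f : V₁ →ₗ[K] V₂) {φ : Dual K V₁} {b : V₂} (hb : b ∉ range f) {w : V₁} (hw : f w = 0)
    (hφ : φ w ≠ 0) : rk (f + φ.smulRight b) = rk f + 1 := by
  have hlt : ker (f + φ.smulRight b) < ker f := by
    refine lt_of_le_of_ne (fun x hx => ?_) fun h => hφ ?_
    · exact (apply_eq_zero_of_add_smulRight f hb hx).1
    · exact (apply_eq_zero_of_add_smulRight f hb (h ▸ hw : w ∈ ker (f + φ.smulRight b))).2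
  have h1 := Submodule.finrank_lt_finrank_of_lt hlt
  have h2 := f.finrank_range_add_finrank_ker
  have h3 := (f + φ.smulRight b).finrank_range_add_finrank_ker
  have h4 := rk_add_le f (φ.smulRight b)
  have h5 := rk_smulRight_le_one φ b
  simp only [rk] at *
  omega

theorem exists_dual_eq_one_of_notMem {S : Submodule K V₁} {v : V₁} (hv : v ∉ S) :
    ∃ φ : Dual K V₁, φ v = 1 ∧ ∀ s ∈ S, φ s = 0 := by
  obtain ⟨φ, h1, h2⟩ := Submodule.exists_le_ker_of_notMem hv
  refine ⟨(φ v)⁻¹ • φ, by simp [h1], fun s hs => ?_⟩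
  have : φ s = 0 := h2 hs
  simp [this]

/-- Of the two perturbations by `b ⊗ φ` and `-(b ⊗ φ)` at least one does not lower the rank. -/
theorem exists_rk_le_rk_add_smulRight [NeZero (2 : K)] [FiniteDimensional K V₁]
    [FiniteDimensional K V₂] (f : V₁ →ₗ[K] V₂) (φ : Dual K V₁) (b : V₂) :
    ∃ c : K, c ≠ 0 ∧ rk f ≤ rk (f + φ.smulRight (c • b)) := by
  by_cases hb : b ∈ range f
  · obtain ⟨x, rfl⟩ := hb
    -- One of `c = 1`, `c = -1` works: if `1 + φ x = 0`, then `1 - φ x = 2 ≠ 0`.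
    obtain ⟨c, hc, hcx⟩ : ∃ c : K, c ≠ 0 ∧ 1 + c * φ x ≠ 0 := by
      by_cases h : 1 + φ x = 0
      · refine ⟨-1, by simp, ?_⟩
        rw [eq_neg_of_add_eq_zero_right h]
        simpa [one_add_one_eq_two] using NeZero.ne (2 : K)
      · exact ⟨1, one_ne_zero, by simpa using h⟩
    refine ⟨c, hc, Submodule.finrank_mono ?_⟩
    rintro _ ⟨y, rfl⟩
    -- The perturbed map is `f ∘ (1 + c x ⊗ φ)`; the witness is the Sherman–Morrison inverse of the
    -- second factor applied to `y`.
    refine ⟨y - (c * φ y * (1 + c * φ x)⁻¹) • x, ?_⟩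
    have h : c * φ y = c * φ y * (1 + c * φ x)⁻¹ * (1 + c * φ x) := by field_simp
    calc _ = f y + (c * φ y - c * φ y * (1 + c * φ x)⁻¹ * (1 + c * φ x)) • f x := by
            simp only [LinearMap.add_apply, smulRight_apply, map_sub, map_smul]
            module
      _ = f y := by rw [← h, sub_self, zero_smul, add_zero]
  · refine ⟨1, one_ne_zero, ?_⟩
    rw [one_smul]
    have h : ker (f + φ.smulRight b) ≤ ker f :=
      fun x hx => (apply_eq_zero_of_add_smulRight f hb hx).1
    have h1 := Submodule.finrank_mono h
    have h2 := f.finrank_range_add_finrank_ker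
    have h3 := (f + φ.smulRight b).finrank_range_add_finrank_ker
    simp only [rk]
    omega

end Basic

/-! ### The maps `A + B X C`: invariants and attained ranks -/

section Pencil

variable {K : Type*} [Field K] {E V U Z : Type*}
  [AddCommGroup E] [Module K E] [AddCommGroup V] [Module K V]
  [AddCommGroup U] [Module K U] [AddCommGroup Z] [Module K Z]
  (A : E →ₗ[K] V) (B : U →ₗ[K] V) (C : E →ₗ[K] Z) (X Y : Z →ₗ[K] U)

theorem add_comp_add : A + B ∘ₗ (X + Y) ∘ₗ C = A + B ∘ₗ X ∘ₗ C + B ∘ₗ Y ∘ₗ C := by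
  rw [add_comp, comp_add, add_assoc]

theorem comp_smulRight_comp (φ : Dual K Z) (u : U) :
    B ∘ₗ φ.smulRight u ∘ₗ C = (φ ∘ₗ C).smulRight (B u) := by
  ext x
  simp

theorem range_sup_range_add_comp : range (A + B ∘ₗ X ∘ₗ C) ⊔ range B = range A ⊔ range B := by
  apply le_antisymm
  · refine sup_le ?_ le_sup_right
    rintro _ ⟨x, rfl⟩
    exact Submodule.add_mem_sup ⟨x, rfl⟩ ⟨X (C x), rfl⟩
  · refine sup_le ?_ le_sup_right
    rintro _ ⟨x, rfl⟩
    have : A x = (A + B ∘ₗ X ∘ₗ C) x + B (-X (C x)) := by simp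
    rw [this]
    exact Submodule.add_mem_sup ⟨x, rfl⟩ ⟨_, rfl⟩

theorem ker_add_comp_inf_ker : ker (A + B ∘ₗ X ∘ₗ C) ⊓ ker C = ker A ⊓ ker C := by
  ext x
  simp +contextual [Submodule.mem_inf]

theorem map_ker_add_comp : (ker C).map (A + B ∘ₗ X ∘ₗ C) = (ker C).map A := by
  ext y
  simp only [Submodule.mem_map, mem_ker]
  refine exists_congr fun x => and_congr_right fun hx => ?_
  simp [hx]

variable [FiniteDimensional K E] [FiniteDimensional K U]

theorem rk_add_finrank_range :
    rk A + rk B =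
      finrank K (range A ⊔ range B : Submodule K V) +
        finrank K (range A ⊓ range B : Submodule K V) :=
  (Submodule.finrank_sup_add_finrank_inf_eq _ _).symm

variable [FiniteDimensional K V] [FiniteDimensional K Z]

theorem exists_rk_add_comp_eq_succ (h1 : ¬ range B ≤ range A) (h2 : ¬ ker A ≤ ker C) :
    ∃ (φ : Dual K Z) (u : U), rk (A + B ∘ₗ φ.smulRight u ∘ₗ C) = rk A + 1 := by
  obtain ⟨_, ⟨u, rfl⟩, hu⟩ := SetLike.not_le_iff_exists.1 h1
  obtain ⟨w, hw, hCw⟩ := SetLike.not_le_iff_exists.1 h2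
  obtain ⟨φ, hφ, -⟩ := exists_dual_eq_one_of_notMem (S := (⊥ : Submodule K Z)) (v := C w) hCw
  refine ⟨φ, u, ?_⟩
  rw [comp_smulRight_comp]
  exact rk_add_smulRight_of_notMem A hu hw (by simp [hφ])

theorem exists_rk_add_comp_eq_add (j : ℕ)
    (h1 : rk A + j ≤ finrank K (range A ⊔ range B : Submodule K V))
    (h2 : rk A + j + finrank K (ker A ⊓ ker C : Submodule K E) ≤ finrank K E) :
    ∃ X : Z →ₗ[K] U, rk X ≤ j ∧ rk (A + B ∘ₗ X ∘ₗ C) = rk A + j := by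
  induction j with
  | zero => exact ⟨0, by simp [rk], by simp⟩
  | succ j ih =>
    obtain ⟨X, hX, hN⟩ := ih (by omega) (by omega)
    -- Otherwise the current rank would already be `dim (R(A) + R(B))`; `hC` is the analogous
    -- statement for kernels.
    have hB : ¬ range B ≤ range (A + B ∘ₗ X ∘ₗ C) := by
      intro h
      have := range_sup_range_add_comp A B C X
      rw [sup_eq_left.2 h] at this
      rw [← this] at h1
      simp only [rk] at *
      omega
    have hC : ¬ ker (A + B ∘ₗ X ∘ₗ C) ≤ ker C := by
      intro h
      have := ker_add_comp_inf_ker A B C X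
      rw [inf_eq_left.2 h] at this
      rw [← this] at h2
      have := (A + B ∘ₗ X ∘ₗ C).finrank_range_add_finrank_ker
      simp only [rk] at *
      omega
    obtain ⟨φ, u, h⟩ := exists_rk_add_comp_eq_succ _ B C hB hC
    refine ⟨X + φ.smulRight u, ?_, ?_⟩
    · have := rk_add_le X (φ.smulRight u)
      have := rk_smulRight_le_one φ u
      omega
    · rw [add_comp_add, h]
      omega

/-- Adding `φ ⊗ c u` with `u` outside `R(X)` and `φ` nonzero on `ker X` raises `r(X)` for every `c ≠
0`, so `c` is free to be chosen so that the rank of `A + B X C` does not drop. -/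
theorem exists_rk_eq_succ_and_rk_le [NeZero (2 : K)] (hU : rk X < finrank K U)
    (hZ : rk X < finrank K Z) :
    ∃ X' : Z →ₗ[K] U, rk X' = rk X + 1 ∧ rk (A + B ∘ₗ X ∘ₗ C) ≤ rk (A + B ∘ₗ X' ∘ₗ C) := by
  obtain ⟨u, hu⟩ : ∃ u, u ∉ range X := by
    by_contra! h
    have h' : range X = ⊤ := eq_top_iff.2 fun u _ => h u
    rw [rk, h', finrank_top] at hU
    exact lt_irrefl _ hU
  obtain ⟨z, hz, hz0⟩ : ∃ z ∈ ker X, z ≠ 0 := by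
    refine (Submodule.ne_bot_iff _).1 fun h => ?_
    have := X.finrank_range_add_finrank_ker
    rw [h, finrank_bot] at this
    simp only [rk] at hZ
    omega
  obtain ⟨φ, hφ, -⟩ := exists_dual_eq_one_of_notMem (S := (⊥ : Submodule K Z)) (v := z) hz0
  obtain ⟨c, hc, hle⟩ := exists_rk_le_rk_add_smulRight (A + B ∘ₗ X ∘ₗ C) (φ ∘ₗ C) (B u)
  refine ⟨X + φ.smulRight (c • u), ?_, ?_⟩
  · refine rk_add_smulRight_of_notMem X (fun h => hu ?_) hz (by simp [hφ])
    exact (Submodule.smul_mem_iff _ hc).1 h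
  · rwa [add_comp_add, comp_smulRight_comp, map_smul]

theorem exists_rk_eq_and_rk_le [NeZero (2 : K)] {t : ℕ} (hX : rk X ≤ t) (hU : t ≤ finrank K U)
    (hZ : t ≤ finrank K Z) :
    ∃ X' : Z →ₗ[K] U, rk X' = t ∧ rk (A + B ∘ₗ X ∘ₗ C) ≤ rk (A + B ∘ₗ X' ∘ₗ C) := by
  induction t, hX using Nat.le_induction with
  | base => exact ⟨X, rfl, le_rfl⟩
  | succ t _ ih =>
    obtain ⟨X', h1, h2⟩ := ih (by omega) (by omega)
    obtain ⟨X'', h3, h4⟩ := exists_rk_eq_succ_and_rk_le A B C X' (by omega) (by omega)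
    exact ⟨X'', by omega, h2.trans h4⟩

/-- The maximal rank of `A + B X C` over all `X` of rank `t` is at least every `r` not exceeding
the ranks of `[A, B]` and `[A; C]` and `rank A + t`. -/
theorem exists_rk_eq_and_le_rk [NeZero (2 : K)] {t r : ℕ} (hU : t ≤ finrank K U)
    (hZ : t ≤ finrank K Z) (h1 : r ≤ finrank K (range A ⊔ range B : Submodule K V))
    (h2 : r + finrank K (ker A ⊓ ker C : Submodule K E) ≤ finrank K E) (h3 : r ≤ rk A + t) :
    ∃ X : Z →ₗ[K] U, rk X = t ∧ r ≤ rk (A + B ∘ₗ X ∘ₗ C) := by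
  obtain ⟨X, hX, hr⟩ : ∃ X : Z →ₗ[K] U, rk X ≤ t ∧ r ≤ rk (A + B ∘ₗ X ∘ₗ C) := by
    rcases le_total r (rk A) with h | h
    · exact ⟨0, by rw [rk, range_zero, finrank_bot]; omega, by simpa using h⟩
    · obtain ⟨X, hX, hr⟩ := exists_rk_add_comp_eq_add A B C (r - rk A) (by omega) (by omega)
      exact ⟨X, by omega, by omega⟩
  obtain ⟨X', h, h'⟩ := exists_rk_eq_and_rk_le A B C X hX hU hZ
  exact ⟨X', h, hr.trans h'⟩

/-- Take `y = A v = B u` outside `A(ker C)`. Then `C v ∉ C(ker A)`, so some `φ` vanishes on `C(ker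
A)` with `φ (C v) = 1`. Subtracting `B u ⊗ φ C` keeps `ker A` in the kernel and adds `v` to it. -/
theorem exists_rk_add_comp_lt (h : ¬ range A ⊓ range B ≤ (ker C).map A) :
    ∃ (φ : Dual K Z) (u : U), rk (A + B ∘ₗ φ.smulRight u ∘ₗ C) < rk A := by
  obtain ⟨y, ⟨⟨v, hv⟩, ⟨u, hu⟩⟩, hy⟩ := SetLike.not_le_iff_exists.1 h
  have hCv : C v ∉ (ker A).map C := by
    rintro ⟨x, hx, hxv⟩
    refine hy ⟨v - x, ?_, ?_⟩
    · simp [hxv]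
    · rw [map_sub, hv, (hx : A x = 0), sub_zero]
  obtain ⟨φ, hφ, hφ0⟩ := exists_dual_eq_one_of_notMem hCv
  refine ⟨φ, -u, ?_⟩
  rw [comp_smulRight_comp]
  have hlt : ker A < ker (A + (φ ∘ₗ C).smulRight (B (-u))) := by
    refine lt_of_le_of_ne (fun x hx => ?_) fun h => ?_
    · have h0 : φ (C x) = 0 := hφ0 _ ⟨x, hx, rfl⟩
      simpa [h0] using hx
    · have hv0 : v ∈ ker A := by
        rw [h]
        simp [hφ, hu, hv]
      exact hCv ⟨v, hv0, rfl⟩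
  have h1 := Submodule.finrank_lt_finrank_of_lt hlt
  have h2 := A.finrank_range_add_finrank_ker
  have h3 := (A + (φ ∘ₗ C).smulRight (B (-u))).finrank_range_add_finrank_ker
  simp only [rk]
  omega

theorem exists_rk_add_comp_add_le (s : ℕ)
    (hs : s + finrank K ((ker C).map A ⊓ range B : Submodule K V) ≤
      finrank K (range A ⊓ range B : Submodule K V)) :
    ∃ X : Z →ₗ[K] U, rk X ≤ s ∧ rk (A + B ∘ₗ X ∘ₗ C) + s ≤ rk A := by
  induction s with
  | zero => exact ⟨0, by simp [rk], by simp⟩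
  | succ s ih =>
    obtain ⟨X, hX, hN⟩ := ih (by omega)
    by_cases hlt : rk (A + B ∘ₗ X ∘ₗ C) + (s + 1) ≤ rk A
    · exact ⟨X, by omega, hlt⟩
    -- As `R(A) + R(B)` is fixed, the rank falls exactly as `dim (R(N) ∩ R(B))` does; the inclusion
    -- would mean that it has already fallen by `s + 1`.
    have h : ¬ range (A + B ∘ₗ X ∘ₗ C) ⊓ range B ≤ (ker C).map (A + B ∘ₗ X ∘ₗ C) := by
      intro h
      rw [map_ker_add_comp] at h
      have h1 := rk_add_finrank_range A B
      have h2 := rk_add_finrank_range (A + B ∘ₗ X ∘ₗ C) B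
      rw [range_sup_range_add_comp] at h2
      have h3 := Submodule.finrank_mono (le_inf h inf_le_right)
      omega
    obtain ⟨φ, u, h⟩ := exists_rk_add_comp_lt _ B C h
    refine ⟨X + φ.smulRight u, ?_, ?_⟩
    · have := rk_add_le X (φ.smulRight u)
      have := rk_smulRight_le_one φ u
      omega
    · rw [add_comp_add]
      omega

/-- If `R(A) ∩ R(B) ⊆ A (ker C)`, then perturbations `B Y C` with `Y` mapping `C (ker A)` into
the preimage of `R(A)` under `B` do not raise the rank of `A`. -/
theorem rk_add_comp_le_of_map_le (h : range A ⊓ range B ≤ (ker C).map A)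
    (hY : ∀ x ∈ ker A, B (Y (C x)) ∈ range A) : rk (A + B ∘ₗ Y ∘ₗ C) ≤ rk A := by
  -- The new map sends `L = ker A + ker C` into `A(L)`, so its kernel has dimension at least `dim L
  -- - dim A(L) = dim ker A`.
  have hle : (ker A ⊔ ker C).map (A + B ∘ₗ Y ∘ₗ C) ≤ (ker A ⊔ ker C).map A := by
    rw [Submodule.map_sup, map_ker_add_comp]
    refine sup_le ?_ (Submodule.map_mono le_sup_right)
    rintro _ ⟨x, hx, rfl⟩
    refine Submodule.map_mono le_sup_right (h ?_)
    have hx0 : A x = 0 := hx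
    simp only [LinearMap.add_apply, hx0, zero_add, comp_apply]
    exact ⟨hY x hx, ⟨_, rfl⟩⟩
  have h1 := Submodule.finrank_mono hle
  have h2 := finrank_map_add_finrank_inf_ker A (ker A ⊔ ker C)
  have h3 := finrank_map_add_finrank_inf_ker (A + B ∘ₗ Y ∘ₗ C) (ker A ⊔ ker C)
  rw [inf_eq_right.2 le_sup_left] at h2
  have h4 : finrank K ((ker A ⊔ ker C) ⊓ ker (A + B ∘ₗ Y ∘ₗ C) : Submodule K E) ≤
    finrank K (ker (A + B ∘ₗ Y ∘ₗ C)) := Submodule.finrank_mono inf_le_right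
  have h5 := A.finrank_range_add_finrank_ker
  have h6 := (A + B ∘ₗ Y ∘ₗ C).finrank_range_add_finrank_ker
  simp only [rk]
  omega

/-- The ranks attained by the maps whose compression to `W → U ⧸ U₁` is prescribed. -/
theorem exists_rk_eq_and_sub_mem {U₁ S : Submodule K U} (hS : IsCompl U₁ S) {W Q : Submodule K Z}
    (hW : IsCompl W Q) (hYS : range Y ≤ S) (hYQ : Q ≤ ker Y) {t : ℕ} (hYt : rk Y ≤ t)
    (hU : t ≤ finrank K U) (hZ : t ≤ finrank K Z) (ht : t ≤ rk Y + finrank K U₁ + finrank K Q) :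
    ∃ X : Z →ₗ[K] U, rk X = t ∧ ∀ w ∈ W, X w - Y w ∈ U₁ := by
  have hSdim := Submodule.finrank_add_eq_of_isCompl hS
  have hWdim := Submodule.finrank_add_eq_of_isCompl hW
  have hYS' : rk Y ≤ finrank K S := Submodule.finrank_mono hYS
  have hYW : W.map Y = range Y := by
    rw [range_eq_map, ← hW.sup_eq_top, Submodule.map_sup, (Submodule.map_le_iff_le_comap.2 hYQ :
      Q.map Y ≤ ⊥) |> le_bot_iff.1, sup_bot_eq]
  have hker := finrank_map_add_finrank_inf_ker Y W
  rw [hYW] at hker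
  -- First fill the block `Q → S`, which leaves the values on `W` untouched.
  obtain ⟨X₁, -, hX₁⟩ := exists_rk_add_comp_eq_add Y (S.projection U₁ hS.symm)
    (Q.projection W hW.symm) (min t (min (finrank K S) (rk Y + finrank K Q)) - rk Y)
    (by rw [Submodule.range_projection, sup_eq_right.2 hYS]; omega)
    (by rw [Submodule.ker_projection, inf_comm (ker Y)]; simp only [rk] at *; omega)
  set X₂ := Y + S.projection U₁ hS.symm ∘ₗ X₁ ∘ₗ Q.projection W hW.symm with hX₂
  have hX₂W : ∀ w ∈ W, X₂ w = Y w := by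
    intro w hw
    have : Q.projection W hW.symm w = 0 := (Submodule.projection_apply_eq_zero_iff _).2 hw
    simp [hX₂, this]
  by_cases hcase : t ≤ min (finrank K S) (rk Y + finrank K Q)
  · refine ⟨X₂, by omega, fun w hw => ?_⟩
    rw [hX₂W w hw, sub_self]
    exact U₁.zero_mem
  have hX₂S : range X₂ ≤ S := by
    rintro _ ⟨z, rfl⟩
    exact S.add_mem (hYS ⟨z, rfl⟩) (Submodule.projection_apply_mem _ _)
  have hsup : finrank K (range X₂ ⊔ U₁ : Submodule K U) = rk X₂ + finrank K U₁ := by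
    have h := Submodule.finrank_sup_add_finrank_inf_eq (range X₂) U₁
    rwa [(hS.symm.disjoint.mono_left hX₂S).eq_bot, finrank_bot, add_zero] at h
  -- The remaining rank comes from maps `Z → U₁`, invisible modulo `U₁`.
  obtain ⟨X₃, -, hX₃⟩ := exists_rk_add_comp_eq_add X₂ (U₁.projection S hS) LinearMap.id
    (t - rk X₂) (by rw [Submodule.range_projection, hsup]; omega)
    (by rw [ker_id, inf_bot_eq, finrank_bot]; omega)
  refine ⟨_, hX₃.trans (by omega), fun w hw => ?_⟩
  simp only [LinearMap.add_apply, hX₂W w hw, add_sub_cancel_left]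
  exact Submodule.projection_apply_mem _ _

theorem rk_le_rk_add_comp_add : rk A ≤ rk (A + B ∘ₗ X ∘ₗ C) + rk X := by
  have h := rk_add_le (A + B ∘ₗ X ∘ₗ C) (-(B ∘ₗ X ∘ₗ C))
  rw [rk_neg, add_neg_cancel_right] at h
  have := rk_conj_le C X B
  omega

/-- The minimal rank of `A + B X C` over all `X` of rank `t` is at most every `r` not below the
three lower bounds. -/
theorem exists_rk_eq_and_rk_le_of_le {t r : ℕ} (hU : t ≤ finrank K U) (hZ : t ≤ finrank K Z)
    (h1 : finrank K (range A ⊔ range B : Submodule K V) +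
      finrank K ((ker C).map A ⊓ range B : Submodule K V) ≤ r + rk B)
    (h2 : rk A ≤ r + t)
    (h3 : finrank K (range A ⊔ range B : Submodule K V) + finrank K E + t ≤
      r + rk A + finrank K U + finrank K Z + finrank K (ker A ⊓ ker C : Submodule K E)) :
    ∃ X : Z →ₗ[K] U, rk X = t ∧ rk (A + B ∘ₗ X ∘ₗ C) ≤ r := by
  have hAB := rk_add_finrank_range A B
  have hrk := rk_le_rk_add_comp_add A B C
  have he : finrank K ((ker C).map A ⊓ range B : Submodule K V) ≤
      finrank K (range A ⊓ range B : Submodule K V) :=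
    Submodule.finrank_mono (inf_le_inf_right _ map_le_range)
  obtain ⟨k, hk⟩ := Nat.exists_eq_add_of_le' he
  rcases le_total t k with htk | htk
  · obtain ⟨X, hX, hN⟩ := exists_rk_add_comp_add_le A B C t (by omega)
    have := hrk X
    exact ⟨X, by omega, by omega⟩
  obtain ⟨X₁, hX₁, hN⟩ := exists_rk_add_comp_add_le A B C k (by omega)
  set N := A + B ∘ₗ X₁ ∘ₗ C with hNdef
  have hNB := rk_add_finrank_range N B
  rw [hNdef, range_sup_range_add_comp, ← hNdef] at hNB
  -- By the choice of `k`, `R(N) ∩ R(B)` has no larger dimension than its subspace `A(ker C) ∩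
  -- R(B)`.
  have hstable : range N ⊓ range B ≤ (ker C).map N := by
    have hle : (ker C).map N ⊓ range B ≤ range N ⊓ range B := inf_le_inf_right _ map_le_range
    have hmap : (ker C).map N = (ker C).map A := map_ker_add_comp A B C X₁
    refine (Submodule.eq_of_le_of_finrank_le hle ?_).ge.trans inf_le_left
    rw [hmap]
    omega
  obtain ⟨S, hS⟩ := ((range N).comap B).exists_isCompl
  obtain ⟨Q, hQ⟩ := ((ker N).map C).exists_isCompl
  have hgood : ∀ X : Z →ₗ[K] U, (∀ w ∈ (ker N).map C, X w - X₁ w ∈ (range N).comap B) →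
      rk (A + B ∘ₗ X ∘ₗ C) ≤ rk N := by
    intro X hX
    have h := rk_add_comp_le_of_map_le N B C (X - X₁) hstable
      fun x hx => hX (C x) ⟨x, hx, rfl⟩
    rwa [hNdef, ← add_comp_add, add_sub_cancel, ← hNdef] at h
  -- `Y` keeps only the essential block of `X₁`. Its rank is exactly `k`: at most `k` as a
  -- compression of `X₁`, at least `k` because `r(A) ≤ r(A + B Y C) + r(Y)`.
  set Y := S.projection _ hS.symm ∘ₗ X₁ ∘ₗ ((ker N).map C).projection Q hQ with hYdef
  have hYk : rk Y ≤ k := (rk_conj_le _ _ _).trans hX₁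
  have hYX₁ : ∀ w ∈ (ker N).map C, Y w - X₁ w ∈ (range N).comap B := by
    intro w hw
    have : ((ker N).map C).projection Q hQ w = w := Submodule.projection_apply_of_mem_left _ hw
    rw [hYdef, comp_apply, comp_apply, this, ← neg_sub]
    exact Submodule.neg_mem _ (Submodule.sub_projection_mem _ _)
  have hYN := hgood Y hYX₁
  have hYA := hrk Y
  have hYS : range Y ≤ S := by
    rintro _ ⟨z, rfl⟩
    exact Submodule.projection_apply_mem _ _
  have hYQ : Q ≤ ker Y := by
    intro z hz
    have : ((ker N).map C).projection Q hQ z = 0 :=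
      (Submodule.projection_apply_eq_zero_iff _).2 hz
    simp [hYdef, this]
  have hYgood : ∀ X : Z →ₗ[K] U, (∀ w ∈ (ker N).map C, X w - Y w ∈ (range N).comap B) →
      rk (A + B ∘ₗ X ∘ₗ C) ≤ rk N := fun X hX => hgood X fun w hw => by
    have := Submodule.add_mem _ (hX w hw) (hYX₁ w hw)
    rwa [sub_add_sub_cancel] at this
  have hU₁ : finrank K ((range N).comap B) + rk B =
      finrank K (range N ⊓ range B : Submodule K V) + finrank K U := by
    have h := finrank_map_add_finrank_inf_ker B ((range N).comap B)
    rw [Submodule.map_comap_eq, inf_eq_right.2 (ker_le_comap B), inf_comm] at h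
    have := B.finrank_range_add_finrank_ker
    simp only [rk]
    omega
  have hQdim := Submodule.finrank_add_eq_of_isCompl hQ
  have hW := finrank_map_add_finrank_inf_ker C (ker N)
  rw [hNdef, ker_add_comp_inf_ker, ← hNdef] at hW
  have hNker := N.finrank_range_add_finrank_ker
  by_cases htT : t ≤ rk Y + finrank K ((range N).comap B) + finrank K Q
  · obtain ⟨X, hX, hXY⟩ := exists_rk_eq_and_sub_mem Y hS hQ hYS hYQ (by omega) hU hZ htT
    refine ⟨X, hX, (hYgood X hXY).trans ?_⟩
    simp only [rk] at *
    omega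
  -- Above the threshold `T = r(Y) + dim B⁻¹(R(N)) + dim Q`, take `X` of rank `T` and add `D` of
  -- rank at most `t - T`. The bound `r(N) + t - T` equals `r(G) + r(H) - r(A) + t - p - q`.
  · obtain ⟨X, hX, hXY⟩ := exists_rk_eq_and_sub_mem Y hS hQ hYS hYQ (by omega) (by omega)
      (by omega) le_rfl
    obtain ⟨D, hD, hXD⟩ := exists_rk_add_comp_eq_add X LinearMap.id LinearMap.id (t - rk X)
      (by rw [range_id, sup_top_eq, finrank_top]; omega)
      (by rw [ker_id, inf_bot_eq, finrank_bot]; omega)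
    refine ⟨X + D, by rw [id_comp, comp_id] at hXD; omega, ?_⟩
    have h4 := hYgood X hXY
    have h5 := rk_add_le (A + B ∘ₗ X ∘ₗ C) (B ∘ₗ D ∘ₗ C)
    have h6 := rk_conj_le C D B
    rw [add_comp_add]
    simp only [rk] at *
    omega

/-! ### Bounds valid for every `X` -/

theorem rk_add_comp_le_finrank_sup :
    rk (A + B ∘ₗ X ∘ₗ C) ≤ finrank K (range A ⊔ range B : Submodule K V) := by
  rw [← range_sup_range_add_comp A B C X]
  exact Submodule.finrank_mono le_sup_left

theorem rk_add_comp_add_finrank_inf_le :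
    rk (A + B ∘ₗ X ∘ₗ C) + finrank K (ker A ⊓ ker C : Submodule K E) ≤ finrank K E := by
  rw [← ker_add_comp_inf_ker A B C X, ← (A + B ∘ₗ X ∘ₗ C).finrank_range_add_finrank_ker]
  exact Nat.add_le_add_left (Submodule.finrank_mono inf_le_left) _

theorem rk_add_comp_le : rk (A + B ∘ₗ X ∘ₗ C) ≤ rk A + rk X :=
  (rk_add_le _ _).trans (Nat.add_le_add_left (rk_conj_le C X B) _)

theorem finrank_sup_add_finrank_inf_le_rk_add_comp :
    finrank K (range A ⊔ range B : Submodule K V) +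
      finrank K ((ker C).map A ⊓ range B : Submodule K V) ≤ rk (A + B ∘ₗ X ∘ₗ C) + rk B := by
  rw [rk_add_finrank_range, range_sup_range_add_comp, ← map_ker_add_comp A B C X]
  exact Nat.add_le_add_left (Submodule.finrank_mono (inf_le_inf_right _ map_le_range)) _

/-- The lower bound obtained by factoring `A + B X C` through `id × X` on `R(A) × Z`. -/
theorem finrank_sup_add_rk_le_rk_add_comp :
    finrank K (range A ⊔ range B : Submodule K V) + finrank K E + rk X ≤
      rk (A + B ∘ₗ X ∘ₗ C) + rk A + finrank K U + finrank K Z +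
        finrank K (ker A ⊓ ker C : Submodule K E) := by
  set G : (range A × U) →ₗ[K] V := (range A).subtype.coprod B with hG
  set D : (range A × Z) →ₗ[K] (range A × U) := LinearMap.id.prodMap X with hD
  set H : E →ₗ[K] (range A × Z) := A.rangeRestrict.prod C with hH
  have hfac : A + B ∘ₗ X ∘ₗ C = G ∘ₗ D ∘ₗ H := by
    ext x
    simp [hG, hD, hH]
  have hrG : rk G = finrank K (range A ⊔ range B : Submodule K V) := by
    rw [rk, hG, range_coprod, Submodule.range_subtype]
  have hkH : ker H = ker A ⊓ ker C := by
    rw [hH, ker_prod, ker_rangeRestrict]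
  have hkD : finrank K (ker D) = finrank K (ker X) := by
    rw [hD, ker_prodMap, ker_id, ← Submodule.map_inr]
    exact LinearEquiv.finrank_eq (Submodule.equivMapOfInjective _ inr_injective _).symm
  have h1 := rk_add_rk_le_rk_comp_add H D
  have h2 := rk_add_rk_le_rk_comp_add (D ∘ₗ H) G
  rw [← hfac] at h2
  have h3 := D.finrank_range_add_finrank_ker
  have h4 := X.finrank_range_add_finrank_ker
  have h5 := H.finrank_range_add_finrank_ker
  rw [hkH] at h5
  rw [hkD] at h3
  simp only [finrank_prod, rk] at *
  omega

end Pencil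

/-! ### Translation to block matrices -/

section Matrix

open scoped ComplexOrder

variable {K : Type*} [Field K] {m n p q : Type*} [Fintype m] [Fintype n] [Fintype p] [Fintype q]

theorem finrank_range_mulVecLin (A : Matrix m n K) : finrank K (range A.mulVecLin) = A.rank :=
  rfl

theorem range_mulVecLin_fromCols (A : Matrix m n K) (B : Matrix m p K) :
    range (Matrix.fromCols A B).mulVecLin = range A.mulVecLin ⊔ range B.mulVecLin := by
  apply le_antisymm
  · rintro _ ⟨x, rfl⟩
    rw [Matrix.mulVecLin_apply, Matrix.fromCols_mulVec]
    exact Submodule.add_mem_sup ⟨_, rfl⟩ ⟨_, rfl⟩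
  · refine sup_le ?_ ?_
    · rintro _ ⟨x, rfl⟩
      exact ⟨Sum.elim x 0, by simp⟩
    · rintro _ ⟨x, rfl⟩
      exact ⟨Sum.elim 0 x, by simp⟩

theorem rank_fromCols (A : Matrix m n K) (B : Matrix m p K) :
    (Matrix.fromCols A B).rank =
      finrank K (range A.mulVecLin ⊔ range B.mulVecLin : Submodule K (m → K)) := by
  rw [Matrix.rank, range_mulVecLin_fromCols]

theorem ker_mulVecLin_fromRows (A : Matrix m n K) (C : Matrix q n K) :
    ker (Matrix.fromRows A C).mulVecLin = ker A.mulVecLin ⊓ ker C.mulVecLin := by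
  ext x
  simp [Matrix.fromRows_mulVec, Sum.elim_eq_iff, ← Sum.elim_zero_zero]

theorem rank_fromRows_add (A : Matrix m n K) (C : Matrix q n K) :
    (Matrix.fromRows A C).rank +
      finrank K (ker A.mulVecLin ⊓ ker C.mulVecLin : Submodule K (n → K)) = Fintype.card n := by
  rw [← ker_mulVecLin_fromRows, Matrix.rank, finrank_range_add_finrank_ker,
    finrank_fintype_fun_eq_card]

theorem rank_fromRows (A : Matrix m n K) (C : Matrix q n K) :
    (Matrix.fromRows A C).rank =
      C.rank + finrank K ((ker C.mulVecLin).map A.mulVecLin) := by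
  have h1 := rank_fromRows_add A C
  have h2 := finrank_map_add_finrank_inf_ker A.mulVecLin (ker C.mulVecLin)
  have h3 := C.mulVecLin.finrank_range_add_finrank_ker
  rw [inf_comm] at h2
  rw [finrank_fintype_fun_eq_card] at h3
  rw [finrank_range_mulVecLin] at h3
  omega

/-- The kernel of `[C, 0]` is `ker C × Kᵖ`, and `[A, B]` maps it onto `A(ker C) + R(B)`. -/
theorem rank_fromBlocks_zero (A : Matrix m n K) (B : Matrix m p K) (C : Matrix q n K) :
    (Matrix.fromBlocks A B C 0).rank = C.rank +
      finrank K ((ker C.mulVecLin).map A.mulVecLin ⊔ range B.mulVecLin : Submodule K (m → K)) := by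
  have hmap : (ker (Matrix.fromCols C (0 : Matrix q p K)).mulVecLin).map
      (Matrix.fromCols A B).mulVecLin =
        (ker C.mulVecLin).map A.mulVecLin ⊔ range B.mulVecLin := by
    apply le_antisymm
    · rintro _ ⟨x, hx, rfl⟩
      rw [Matrix.mulVecLin_apply, Matrix.fromCols_mulVec]
      refine Submodule.add_mem_sup ⟨_, ?_, rfl⟩ ⟨_, rfl⟩
      simpa [Matrix.fromCols_mulVec] using hx
    · refine sup_le ?_ ?_
      · rintro _ ⟨x, hx, rfl⟩
        refine ⟨Sum.elim x 0, ?_, by simp⟩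
        simpa [Matrix.fromCols_mulVec_sumElim] using hx
      · rintro _ ⟨x, rfl⟩
        exact ⟨Sum.elim 0 x, by simp,
          by simp⟩
  rw [← Matrix.fromRows_fromCols_eq_fromBlocks, rank_fromRows, hmap, rank_fromCols,
    Matrix.mulVecLin_zero, range_zero, sup_bot_eq, Matrix.rank]

theorem rank_add_rank_le_rank_fromBlocks (A : Matrix m n K) (B : Matrix m p K)
    (C : Matrix q n K) : B.rank + C.rank ≤ (Matrix.fromBlocks A B C 0).rank := by
  rw [rank_fromBlocks_zero, add_comm]
  exact Nat.add_le_add_left (Submodule.finrank_mono le_sup_right) _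

theorem rank_fromBlocks_zero_of_range_le (A : Matrix m n K) (B : Matrix m p K)
    (C : Matrix q n K) (h : range A.mulVecLin ≤ range B.mulVecLin) :
    (Matrix.fromBlocks A B C 0).rank = B.rank + C.rank := by
  rw [rank_fromBlocks_zero, sup_eq_right.2 (map_le_range.trans h), finrank_range_mulVecLin,
    add_comm]

theorem rank_fromBlocks_zero_add (A : Matrix m n K) (B : Matrix m p K) (C : Matrix q n K) :
    (Matrix.fromBlocks A B C 0).rank +
      finrank K ((ker C.mulVecLin).map A.mulVecLin ⊓ range B.mulVecLin : Submodule K (m → K)) =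
      (Matrix.fromRows A C).rank + B.rank := by
  rw [rank_fromBlocks_zero, rank_fromRows, add_assoc, add_assoc,
    Submodule.finrank_sup_add_finrank_inf_eq, finrank_range_mulVecLin]

theorem rank_fromBlocks_zero_le_add (A : Matrix m n K) (B : Matrix m p K) (C : Matrix q n K) :
    (Matrix.fromBlocks A B C 0).rank ≤
      (Matrix.fromCols A B).rank + (Matrix.fromRows A C).rank := by
  have h := rank_fromBlocks_zero_add A B C
  have hB : B.rank ≤ (Matrix.fromCols A B).rank := by
    rw [rank_fromCols]
    exact Submodule.finrank_mono le_sup_right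
  omega

theorem rank_add_mul_mul (A : Matrix m n K) (B : Matrix m p K) (C : Matrix q n K)
    (X : Matrix p q K) :
    (A + B * X * C).rank =
      rk (A.mulVecLin + B.mulVecLin ∘ₗ X.mulVecLin ∘ₗ C.mulVecLin) := by
  rw [Matrix.rank, Matrix.mulVecLin_add, Matrix.mulVecLin_mul, Matrix.mulVecLin_mul, comp_assoc]

theorem rank_add_mul_mul_le (A : Matrix m n K) (B : Matrix m p K) (C : Matrix q n K)
    (X : Matrix p q K) :
    (A + B * X * C).rank ≤ (Matrix.fromCols A B).rank ∧
      (A + B * X * C).rank ≤ (Matrix.fromRows A C).rank ∧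
      (A + B * X * C).rank ≤ A.rank + X.rank := by
  have h1 := rk_add_comp_le_finrank_sup A.mulVecLin B.mulVecLin C.mulVecLin X.mulVecLin
  have h2 := rk_add_comp_add_finrank_inf_le A.mulVecLin B.mulVecLin C.mulVecLin X.mulVecLin
  have h3 := rk_add_comp_le A.mulVecLin B.mulVecLin C.mulVecLin X.mulVecLin
  have h4 := rank_fromRows_add A C
  rw [← rank_add_mul_mul] at h1 h2 h3
  rw [finrank_fintype_fun_eq_card] at h2
  rw [rank_fromCols]
  exact ⟨h1, by omega, h3⟩

theorem le_rank_add_mul_mul (A : Matrix m n K) (B : Matrix m p K) (C : Matrix q n K)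
    (X : Matrix p q K) :
    (Matrix.fromCols A B).rank + (Matrix.fromRows A C).rank ≤
        (A + B * X * C).rank + (Matrix.fromBlocks A B C 0).rank ∧
      (Matrix.fromCols A B).rank + (Matrix.fromRows A C).rank + X.rank ≤
        (A + B * X * C).rank + A.rank + Fintype.card p + Fintype.card q ∧
      A.rank ≤ (A + B * X * C).rank + X.rank := by
  have h1 := finrank_sup_add_finrank_inf_le_rk_add_comp
    A.mulVecLin B.mulVecLin C.mulVecLin X.mulVecLin
  have h2 := finrank_sup_add_rk_le_rk_add_comp A.mulVecLin B.mulVecLin C.mulVecLin X.mulVecLin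
  have h3 := rk_le_rk_add_comp_add A.mulVecLin B.mulVecLin C.mulVecLin X.mulVecLin
  have h4 := rank_fromRows_add A C
  have h5 := rank_fromBlocks_zero_add A B C
  rw [← rank_add_mul_mul] at h1 h2 h3
  simp only [finrank_fintype_fun_eq_card, ← rank_fromCols] at h1 h2
  simp only [rk, finrank_range_mulVecLin] at h1 h2 h3
  exact ⟨by omega, by omega, h3⟩

theorem exists_rank_eq_and_le_rank [NeZero (2 : K)] (A : Matrix m n K) (B : Matrix m p K)
    (C : Matrix q n K) {t r : ℕ} (hp : t ≤ Fintype.card p) (hq : t ≤ Fintype.card q)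
    (h1 : r ≤ (Matrix.fromCols A B).rank) (h2 : r ≤ (Matrix.fromRows A C).rank)
    (h3 : r ≤ A.rank + t) : ∃ X : Matrix p q K, X.rank = t ∧ r ≤ (A + B * X * C).rank := by
  classical
  have h4 := rank_fromRows_add A C
  rw [rank_fromCols] at h1
  obtain ⟨X, hX, hr⟩ := exists_rk_eq_and_le_rk A.mulVecLin B.mulVecLin C.mulVecLin (t := t)
    (r := r) (by simpa using hp) (by simpa using hq) h1
    (by rw [finrank_fintype_fun_eq_card]; omega) h3
  have hX' : (LinearMap.toMatrix' X).mulVecLin = X := by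
    rw [← Matrix.toLin'_apply', Matrix.toLin'_toMatrix']
  exact ⟨LinearMap.toMatrix' X, by rw [Matrix.rank, hX', ← hX], by rwa [rank_add_mul_mul, hX']⟩

theorem exists_rank_eq_and_rank_le (A : Matrix m n K) (B : Matrix m p K)
    (C : Matrix q n K) {t r : ℕ} (hp : t ≤ Fintype.card p) (hq : t ≤ Fintype.card q)
    (h1 : (Matrix.fromCols A B).rank + (Matrix.fromRows A C).rank ≤
      r + (Matrix.fromBlocks A B C 0).rank)
    (h2 : (Matrix.fromCols A B).rank + (Matrix.fromRows A C).rank + t ≤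
      r + A.rank + Fintype.card p + Fintype.card q)
    (h3 : A.rank ≤ r + t) : ∃ X : Matrix p q K, X.rank = t ∧ (A + B * X * C).rank ≤ r := by
  classical
  have h4 := rank_fromRows_add A C
  have h5 := rank_fromBlocks_zero_add A B C
  rw [rank_fromCols] at h1 h2
  obtain ⟨X, hX, hr⟩ := exists_rk_eq_and_rk_le_of_le A.mulVecLin B.mulVecLin C.mulVecLin (t := t)
    (r := r) (by simpa using hp) (by simpa using hq)
    (by simp only [rk, finrank_range_mulVecLin]; omega) h3
    (by simp only [finrank_fintype_fun_eq_card, rk, finrank_range_mulVecLin]; omega)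
  have hX' : (LinearMap.toMatrix' X).mulVecLin = X := by
    rw [← Matrix.toLin'_apply', Matrix.toLin'_toMatrix']
  exact ⟨LinearMap.toMatrix' X, by rw [Matrix.rank, hX', ← hX], by rwa [rank_add_mul_mul, hX']⟩

theorem rank_fromCols_eq_right_iff (A : Matrix m n K) (B : Matrix m p K) :
    (Matrix.fromCols A B).rank = B.rank ↔ range A.mulVecLin ≤ range B.mulVecLin := by
  rw [rank_fromCols, Matrix.rank]
  constructor
  · intro h
    rw [Submodule.eq_of_le_of_finrank_eq (le_sup_right : range B.mulVecLin ≤ _) h.symm]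
    exact le_sup_left
  · intro h
    rw [sup_eq_right.2 h]

theorem rank_fromCols_eq_add_iff (A : Matrix m n K) (B : Matrix m p K) :
    (Matrix.fromCols A B).rank = A.rank + B.rank ↔ range A.mulVecLin ⊓ range B.mulVecLin = ⊥ := by
  have h := Submodule.finrank_sup_add_finrank_inf_eq (range A.mulVecLin) (range B.mulVecLin)
  rw [rank_fromCols, ← Submodule.finrank_eq_zero (R := K)]
  simp only [Matrix.rank]
  omega

theorem rank_fromCols_le_add (A : Matrix m n K) (B : Matrix m p K) :
    (Matrix.fromCols A B).rank ≤ A.rank + B.rank := by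
  rw [rank_fromCols]
  exact Submodule.finrank_add_le_finrank_add_finrank _ _

theorem rank_le_rank_fromCols_left (A : Matrix m n K) (B : Matrix m p K) :
    A.rank ≤ (Matrix.fromCols A B).rank := by
  rw [rank_fromCols]
  exact Submodule.finrank_mono le_sup_left

theorem matrix_rank_eq_zero_iff (N : Matrix m n K) : N.rank = 0 ↔ N = 0 := by
  classical
  rw [Matrix.rank, Submodule.finrank_eq_zero, range_eq_bot, ← Matrix.toLin'_apply',
    LinearEquiv.map_eq_zero_iff]

theorem isUnit_iff_rank_eq {K : Type*} [Field K] {m : ℕ} (N : Matrix (Fin m) (Fin m) K) :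
    IsUnit N ↔ N.rank = m := by
  constructor
  · intro h
    simpa using Matrix.rank_of_isUnit N h
  · intro h
    rw [← Matrix.mulVec_surjective_iff_isUnit]
    have htop : LinearMap.range N.mulVecLin = ⊤ :=
      Submodule.eq_top_of_finrank_eq (h.trans (by simp))
    exact LinearMap.range_eq_top.1 htop

theorem rank_conjTranspose_complex (A : Matrix m n ℂ) : A.conjTranspose.rank = A.rank :=
  Matrix.rank_conjTranspose A

theorem rank_fromRows_eq_conjTranspose (A : Matrix m n ℂ) (C : Matrix q n ℂ) :
    (Matrix.fromRows A C).rank = (Matrix.fromCols A.conjTranspose C.conjTranspose).rank := by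
  rw [← Matrix.rank_conjTranspose, Matrix.conjTranspose_fromRows_eq_fromCols_conjTranspose]

end Matrix

end RankPerturbation

/-! ### The extremal ranks and their consequences -/

open RankPerturbation

theorem theorem3p1 {m n p q : ℕ}
    (A : Matrix (Fin m) (Fin n) ℂ) (B : Matrix (Fin m) (Fin p) ℂ) (C : Matrix (Fin q) (Fin n) ℂ)
    (t : ℕ) (ht : t ≤ min p q)
    (G : Matrix (Fin m) (Fin n ⊕ Fin p) ℂ) (hG : G = Matrix.fromCols A B)
    (H : Matrix (Fin m ⊕ Fin q) (Fin n) ℂ) (hH : H = Matrix.fromRows A C)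
    (M : Matrix (Fin m ⊕ Fin q) (Fin n ⊕ Fin p) ℂ) (hM : M = Matrix.fromBlocks A B C 0) :
    -- the maximal and the minimal rank
    IsGreatest (rankValues A B C t)
      (min (G.rank : ℤ) (min (H.rank : ℤ) ((A.rank : ℤ) + t))) ∧
    IsLeast (rankValues A B C t)
      (max ((G.rank : ℤ) + H.rank - M.rank)
        (max ((G.rank : ℤ) + H.rank - A.rank + t - p - q) ((A.rank : ℤ) - t))) ∧
    -- (a) for `m = n`; the column index set `Fin n` is identified with `Fin m`
    (∀ h : m = n,
      ((∃ X ∈ fixedRank p q t, IsUnit ((A + B * X * C).submatrix id (Fin.cast h))) ↔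
        (G.rank = m ∧ H.rank = m ∧ (A.rank : ℤ) ≥ (m : ℤ) - t))) ∧
    -- (b)
    ((∃ X ∈ fixedRank p q t, A + B * X * C = 0) ↔
      (colSpace A ≤ colSpace B ∧
        colSpace A.conjTranspose ≤ colSpace C.conjTranspose ∧
        (G.rank : ℤ) + H.rank ≤ (A.rank : ℤ) - t + p + q ∧
        A.rank ≤ t)) ∧
    -- (c)
    (t ≠ 0 →
      ((∀ X ∈ fixedRank p q t, ∀ Y ∈ fixedRank p q t,
          (A + B * X * C).rank = (A + B * Y * C).rank) ↔
        (M.rank = G.rank ∨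
          M.rank = H.rank ∨
          (M.rank : ℤ) = (G.rank : ℤ) + H.rank - A.rank - t ∨
          (G.rank : ℤ) = (A.rank : ℤ) + p + q - t ∨
          (H.rank : ℤ) = (A.rank : ℤ) + p + q - t ∨
          G.rank + H.rank = 2 * A.rank + p + q))) ∧
    -- the reformulation of the last condition in (c)
    (G.rank + H.rank = 2 * A.rank + p + q ↔
      (B.rank = p ∧ C.rank = q ∧
        colSpace A ⊓ colSpace B = ⊥ ∧
        colSpace A.conjTranspose ⊓ colSpace C.conjTranspose = ⊥)) ∧
    -- (d)
    (colSpace A ≤ colSpace B → colSpace A.conjTranspose ≤ colSpace C.conjTranspose →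
      IsGreatest (rankValues A B C t)
        (min (B.rank : ℤ) (min (C.rank : ℤ) ((A.rank : ℤ) + t))) ∧
      IsLeast (rankValues A B C t)
        (max 0 (max ((B.rank : ℤ) + C.rank - A.rank + t - p - q) ((A.rank : ℤ) - t)))) := by

  obtain ⟨htp, htq⟩ := le_min_iff.1 ht
  have hub : ∀ X ∈ fixedRank p q t, (A + B * X * C).rank ≤ G.rank ∧
      (A + B * X * C).rank ≤ H.rank ∧ (A + B * X * C).rank ≤ A.rank + t := by
    rintro X rfl
    rw [hG, hH]
    exact rank_add_mul_mul_le A B C X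
  have hlb : ∀ X ∈ fixedRank p q t, G.rank + H.rank ≤ (A + B * X * C).rank + M.rank ∧
      G.rank + H.rank + t ≤ (A + B * X * C).rank + A.rank + p + q ∧
      A.rank ≤ (A + B * X * C).rank + t := by
    rintro X rfl
    rw [hG, hH, hM]
    simpa using le_rank_add_mul_mul A B C X
  have hAM : G.rank + H.rank ≤ A.rank + M.rank := by
    rw [hG, hH, hM]
    simpa using (le_rank_add_mul_mul A B C 0).1
  obtain ⟨X₁, hX₁, hN₁⟩ : ∃ X ∈ fixedRank p q t,
      min G.rank (min H.rank (A.rank + t)) ≤ (A + B * X * C).rank := by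
    rw [hG, hH]
    exact exists_rank_eq_and_le_rank A B C (by simpa using htp) (by simpa using htq)
      (by omega) (by omega) (by omega)
  obtain ⟨X₂, hX₂, hN₂⟩ : ∃ X ∈ fixedRank p q t, ((A + B * X * C).rank : ℤ) ≤
      max ((G.rank : ℤ) + H.rank - M.rank)
        (max ((G.rank : ℤ) + H.rank - A.rank + t - p - q) ((A.rank : ℤ) - t)) := by
    set r := max ((G.rank : ℤ) + H.rank - M.rank)
        (max ((G.rank : ℤ) + H.rank - A.rank + t - p - q) ((A.rank : ℤ) - t)) with hr
    -- Nonnegativity of the bound makes `r.toNat` faithful.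
    have hGM : 0 ≤ (G.rank : ℤ) + H.rank - M.rank := by
      have h := rank_fromBlocks_zero_le_add A B C
      rw [← hG, ← hH, ← hM] at h
      omega
    have hr0 : 0 ≤ r := hGM.trans (le_max_left _ _)
    obtain ⟨X, hX, hN⟩ := exists_rank_eq_and_rank_le A B C (t := t) (r := r.toNat)
      (by simpa using htp) (by simpa using htq) (by rw [← hG, ← hH, ← hM]; omega)
      (by rw [← hG, ← hH]; simp only [Fintype.card_fin]; omega) (by omega)
    exact ⟨X, hX, by omega⟩
  have hub₁ := hub X₁ hX₁
  have hlb₁ := hlb X₁ hX₁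
  have hub₂ := hub X₂ hX₂
  have hlb₂ := hlb X₂ hX₂
  have hmax : IsGreatest (rankValues A B C t)
      (min (G.rank : ℤ) (min (H.rank : ℤ) ((A.rank : ℤ) + t))) := by
    refine ⟨⟨X₁, hX₁, ?_⟩, ?_⟩
    · change ((A + B * X₁ * C).rank : ℤ) = _
      omega
    · rintro _ ⟨X, hX, rfl⟩
      have := hub X hX
      change ((A + B * X * C).rank : ℤ) ≤ _
      omega
  have hmin : IsLeast (rankValues A B C t)
      (max ((G.rank : ℤ) + H.rank - M.rank)
        (max ((G.rank : ℤ) + H.rank - A.rank + t - p - q) ((A.rank : ℤ) - t))) := by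
    refine ⟨⟨X₂, hX₂, ?_⟩, ?_⟩
    · change ((A + B * X₂ * C).rank : ℤ) = _
      omega
    · rintro _ ⟨X, hX, rfl⟩
      have := hlb X hX
      change _ ≤ ((A + B * X * C).rank : ℤ)
      omega
  have hH' := rank_fromRows_eq_conjTranspose A C
  rw [← hH] at hH'
  have hAG : A.rank ≤ G.rank := hG ▸ rank_le_rank_fromCols_left A B
  have hAH : A.rank ≤ H.rank := by
    rw [hH', ← rank_conjTranspose_complex A]
    exact rank_le_rank_fromCols_left _ _
  have hGle : G.rank ≤ A.rank + B.rank := hG ▸ rank_fromCols_le_add A B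
  have hHle : H.rank ≤ A.rank + C.rank := by
    rw [hH', ← rank_conjTranspose_complex A, ← rank_conjTranspose_complex C]
    exact rank_fromCols_le_add _ _
  have hBp : B.rank ≤ p := B.rank_le_width
  have hCq : C.rank ≤ q := C.rank_le_height
  have hGB : G.rank = B.rank ↔ colSpace A ≤ colSpace B := hG ▸ rank_fromCols_eq_right_iff A B
  have hHC : H.rank = C.rank ↔ colSpace A.conjTranspose ≤ colSpace C.conjTranspose := by
    rw [hH', ← rank_conjTranspose_complex C]
    exact rank_fromCols_eq_right_iff _ _
  have hGadd : G.rank = A.rank + B.rank ↔ colSpace A ⊓ colSpace B = ⊥ :=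
    hG ▸ rank_fromCols_eq_add_iff A B
  have hHadd : H.rank = A.rank + C.rank ↔
      colSpace A.conjTranspose ⊓ colSpace C.conjTranspose = ⊥ := by
    rw [hH', ← rank_conjTranspose_complex A, ← rank_conjTranspose_complex C]
    exact rank_fromCols_eq_add_iff _ _
  have hBCM : B.rank + C.rank ≤ M.rank := hM ▸ rank_add_rank_le_rank_fromBlocks A B C
  refine ⟨hmax, hmin, ?_, ?_, ?_, ?_, ?_⟩
  · rintro rfl
    have hGm : G.rank ≤ m := G.rank_le_card_height.trans (by simp)
    have hHm : H.rank ≤ m := H.rank_le_card_width.trans (by simp)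
    change (∃ X ∈ fixedRank p q t, IsUnit (A + B * X * C)) ↔ _
    simp only [isUnit_iff_rank_eq]
    constructor
    · rintro ⟨X, hX, h⟩
      have := hub X hX
      omega
    · rintro ⟨h1, h2, h3⟩
      exact ⟨X₁, hX₁, by omega⟩
  · rw [← hGB, ← hHC]
    constructor
    · rintro ⟨X, hX, h⟩
      have hr := hlb X hX
      rw [h, Matrix.rank_zero] at hr
      have hA : A = B * (-X * C) := by
        rw [eq_neg_of_add_eq_zero_left h, Matrix.mul_assoc, Matrix.neg_mul, Matrix.mul_neg]
      have hA' : A.conjTranspose = C.conjTranspose * (B * -X).conjTranspose := by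
        rw [← Matrix.conjTranspose_mul, Matrix.mul_assoc, ← hA]
      refine ⟨hGB.2 ?_, hHC.2 ?_, by omega, by omega⟩
      · rw [hA, colSpace, Matrix.mulVecLin_mul]
        exact LinearMap.range_comp_le_range _ _
      · rw [hA', colSpace, Matrix.mulVecLin_mul]
        exact LinearMap.range_comp_le_range _ _
    · rintro ⟨h1, h2, h3, h4⟩
      refine ⟨X₂, hX₂, ?_⟩
      rw [← matrix_rank_eq_zero_iff]
      omega
  -- The rank is constant iff the maximum equals the minimum. Of the nine possible coincidences of
  -- terms, six are (i)–(vi); those with `r(A) - t` are excluded by `t ≠ 0` and `r(A) ≤ r(G), r(H)`.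
  · intro ht0
    constructor
    · intro h
      have := h X₁ hX₁ X₂ hX₂
      omega
    · intro h X hX Y hY
      have := hub X hX
      have := hlb X hX
      have := hub Y hY
      have := hlb Y hY
      omega
  -- Since `r(G) ≤ r(A) + r(B) ≤ r(A) + p`, and likewise for `H`, equality of the sums forces
  -- equality throughout.
  · rw [← hGadd, ← hHadd]
    omega
  · intro hAB hAC
    have h1 := hGB.2 hAB
    have h2 := hHC.2 hAC
    have h3 : M.rank = B.rank + C.rank :=
      hM ▸ rank_fromBlocks_zero_of_range_le A B C hAB
    rw [h1, h2] at hmax hmin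
    rw [h3] at hmin
    refine ⟨hmax, ?_⟩
    -- Here `r(M) = r(B) + r(C)`, so the first term of the maximum is `0`.
    convert hmin using 2
    omega
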